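/- Let $(f(p))_{p\text{ prime}}$ be independent random variables, each taking the values $+1$ and $-1$ with probability $1/2$, and let $f$ be the random completely multiplicative function they generate, i.e. $f(n)=\prod_{p^k\| n} f(p)^k$ for all integers $n\ge 1$. Then there exist absolute constants $C>0$, $K>0$ and $x_0$ such that for every real $x\ge x_0$, $$\mathbb{P}\left(\sum_{n\le x}\frac{f(n)}{n}<0\right)\le K\exp\left(-\exp\left(\frac{\log x\cdot\log\log\log x}{C\log\log x}\right)\right).$$ -/

import Mathlib

open MeasureTheory ProbabilityTheory

/-- `(X p)`, with `p` running over the primes, is a sequence of independent random variables on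
the probability space `(Ω, P)`, each taking the values `1` and `-1` with probability `1 / 2`.
The values `X n` at non-prime indices `n` play no role. -/
structure IsRademacherOnPrimes {Ω : Type*} [MeasurableSpace Ω] (P : Measure Ω)
    (X : ℕ → Ω → ℝ) : Prop where
  measurable : ∀ p : ℕ, p.Prime → Measurable (X p)
  indep : iIndepFun (fun p : Nat.Primes => X (p : ℕ)) P
  prob_one : ∀ p : ℕ, p.Prime → P.real {ω | X p ω = 1} = 1 / 2
  prob_neg_one : ∀ p : ℕ, p.Prime → P.real {ω | X p ω = -1} = 1 / 2

/-- The completely multiplicative function with prescribed values `a p` at the primes `p`: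
`f(n) = ∏_{p ^ k ∥ n} (a p) ^ k` for `n ≥ 1`. -/
noncomputable def completelyMultiplicativeExt (a : ℕ → ℝ) (n : ℕ) : ℝ :=
  n.factorization.prod fun p k => a p ^ k

/-! Fix `w = (2k)^4` and split the sum over `n ≤ x` into `w`-smooth `n` and the rest, `Z`. The
smooth part is, up to a Rankin tail, the Euler product over primes below `w`, which is always at
least `exp(-∑ 1/p)`, hence at least `exp(-M)` for any upper bound `M` of `∑ 1/p`. If the tail is at
most half of this (`abs_sum_smoothNumbers_sub_eulerProduct_le`), a negative total forces `|Z| ≥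
exp(-M)/2`.

That is excluded by the `2k`-th moment of `Z`. All moments `E f(n)` are nonnegative, so enlarging
the range of summation only increases the moment (`integral_mul_sum_pow_mono`). One may therefore
sum over all `N`-smooth, non-`w`-smooth integers, where the sum factors as (product over `p < w`)
times (`R - 1`), with `R` the product over `w ≤ p < N`. The sum of `f(p)/p` over these primes is
sub-Gaussian with variance at most `2/w`, so `R - 1` has `2k`-th moment `O((2k)^(-2k))`
(`integral_roughProduct_sub_one_pow_le`).

Markov's inequality gives a probability of `O((exp(3M)/k)^(2k))`. Since `exp(3M)` is only a power of
`log k`, this is at most `O(exp(-2k))`. The Rankin tail limits `log k` to order `log x · logloglog x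
/ loglog x`. -/

/-! ### Mertens-type upper bounds for sums over primes -/

/-- The distinct primes dividing `m ≤ w` have product at most `m`. Summing the logarithms over `m`
bounds `∑ ⌊w/p⌋ log p` by `w log w`, and removing the floors costs one Chebyshev bound `θ(w) ≤ w log
4`. -/
theorem sum_log_div_primesBelow_le {w : ℕ} (hw : 2 ≤ w) :
    ∑ p ∈ w.primesBelow, Real.log p / p ≤ Real.log w + Real.log 4 := by
  have hw0 : (0 : ℝ) < w := by positivity
  have key : ∑ p ∈ w.primesBelow, ((w / p : ℕ) : ℝ) * Real.log p ≤ w * Real.log w := by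
    have h1 : ∀ m ∈ Finset.Ioc 0 w, ∑ p ∈ w.primesBelow, (if p ∣ m then Real.log p else 0)
        ≤ Real.log w := by
      intro m hm
      rw [Finset.mem_Ioc] at hm
      rw [← Finset.sum_filter, ← Real.log_prod]
      · have hdvd : (∏ p ∈ w.primesBelow with p ∣ m, p) ≤ m := by
          refine le_trans ?_ (Nat.le_of_dvd hm.1 (Nat.prod_primeFactors_dvd m))
          refine Finset.prod_le_prod_of_subset_of_one_le' ?_ ?_
          · intro p hp
            rw [Finset.mem_filter, Nat.mem_primesBelow] at hp
            exact Nat.mem_primeFactors.2 ⟨hp.1.2, hp.2, hm.1.ne'⟩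
          · intro p hp _
            exact (Nat.prime_of_mem_primeFactors hp).one_le
        rw [← Nat.cast_prod]
        apply Real.log_le_log
        · rw [Nat.cast_pos]
          exact Finset.prod_pos fun p hp =>
            (Nat.prime_of_mem_primesBelow (Finset.mem_filter.1 hp).1).pos
        · exact_mod_cast hdvd.trans hm.2
      · intro p hp
        exact_mod_cast (Nat.prime_of_mem_primesBelow (Finset.mem_filter.1 hp).1).ne_zero
    calc ∑ p ∈ w.primesBelow, ((w / p : ℕ) : ℝ) * Real.log p
        = ∑ p ∈ w.primesBelow, ∑ m ∈ Finset.Ioc 0 w, (if p ∣ m then Real.log p else 0) := by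
          refine Finset.sum_congr rfl fun p hp => ?_
          rw [← Finset.sum_filter, Finset.sum_const, Nat.Ioc_filter_dvd_card_eq_div, nsmul_eq_mul]
      _ = ∑ m ∈ Finset.Ioc 0 w, ∑ p ∈ w.primesBelow, (if p ∣ m then Real.log p else 0) :=
          Finset.sum_comm
      _ ≤ ∑ m ∈ Finset.Ioc 0 w, Real.log w := Finset.sum_le_sum h1
      _ = w * Real.log w := by simp
  have htheta : ∑ p ∈ w.primesBelow, Real.log p ≤ Real.log 4 * w := by
    refine le_trans ?_ (Chebyshev.theta_le_log4_mul_x hw0.le)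
    rw [Chebyshev.theta_eq_sum_primesLE_log]
    refine Finset.sum_le_sum_of_subset_of_nonneg ?_ ?_
    · intro p hp
      rw [Nat.mem_primesBelow] at hp
      exact Nat.mem_primesLE.2 ⟨hp.1.le, hp.2⟩
    · intro p _ _
      exact Real.log_natCast_nonneg p
  have h2 : w * ∑ p ∈ w.primesBelow, Real.log p / p ≤ w * (Real.log w + Real.log 4) := by
    have : w * ∑ p ∈ w.primesBelow, Real.log p / p
        ≤ ∑ p ∈ w.primesBelow, (((w / p : ℕ) : ℝ) * Real.log p + Real.log p) := by
      rw [Finset.mul_sum]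
      refine Finset.sum_le_sum fun p hp => ?_
      have hl : 0 ≤ Real.log p := Real.log_natCast_nonneg p
      have hfl : (w : ℝ) / p ≤ ((w / p : ℕ) : ℝ) + 1 := by
        rw [← Nat.floor_div_eq_div (K := ℝ)]
        exact (Nat.lt_floor_add_one _).le
      calc (w : ℝ) * (Real.log p / p) = w / p * Real.log p := by ring
        _ ≤ (((w / p : ℕ) : ℝ) + 1) * Real.log p := by gcongr
        _ = _ := by ring
    rw [Finset.sum_add_distrib] at this
    linarith
  exact le_of_mul_le_mul_left h2 hw0

theorem sum_inv_primesBelow_mono {a b : ℕ} (h : a ≤ b) :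
    ∑ p ∈ a.primesBelow, (1 : ℝ) / p ≤ ∑ p ∈ b.primesBelow, (1 : ℝ) / p := by
  refine Finset.sum_le_sum_of_subset_of_nonneg ?_ fun p _ _ => by positivity
  intro p hp
  rw [Nat.mem_primesBelow] at hp ⊢
  exact ⟨hp.1.trans_le h, hp.2⟩

/-- On a block `W ≤ p < W^2`, each `1/p` is at most `(log p / p) / log W`, so the block contributes
at most `(2 log W + 2 log 2) / log W ≤ 4`. Passing from `j` to `j + 1` adds one such block. -/
theorem sum_inv_primesBelow_two_pow_two_pow_le (j : ℕ) :
    ∑ p ∈ Nat.primesBelow (2 ^ 2 ^ j), (1 : ℝ) / p ≤ 4 * j := by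
  induction j with
  | zero =>
    have : Nat.primesBelow (2 ^ 2 ^ 0) = ∅ := by decide
    rw [this]; simp
  | succ j ih =>
    set W : ℕ := 2 ^ 2 ^ j with hW
    have hW2 : 2 ≤ W := by
      calc 2 = 2 ^ 1 := by norm_num
        _ ≤ 2 ^ 2 ^ j := Nat.pow_le_pow_right (by norm_num) Nat.one_le_two_pow
    have hWW : 2 ^ 2 ^ (j + 1) = W ^ 2 := by rw [hW, ← pow_mul, pow_succ]
    have hlogW : Real.log 2 ≤ Real.log W :=
      Real.log_le_log (by norm_num) (by exact_mod_cast hW2)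
    have hl2 : 0 < Real.log 2 := Real.log_pos (by norm_num)
    have hlW : 0 < Real.log W := hl2.trans_le hlogW
    have hsub : W.primesBelow ⊆ (W ^ 2).primesBelow := by
      intro p hp
      rw [Nat.mem_primesBelow] at hp ⊢
      exact ⟨hp.1.trans_le (Nat.le_self_pow (by norm_num) _), hp.2⟩
    rw [hWW, ← Finset.sum_sdiff hsub]
    have h1 : ∑ p ∈ (W ^ 2).primesBelow \ W.primesBelow, (1 : ℝ) / p ≤ 4 := by
      have : Real.log W * ∑ p ∈ (W ^ 2).primesBelow \ W.primesBelow, (1 : ℝ) / p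
          ≤ Real.log W * 4 := by
        calc Real.log W * ∑ p ∈ (W ^ 2).primesBelow \ W.primesBelow, (1 : ℝ) / p
            ≤ ∑ p ∈ (W ^ 2).primesBelow \ W.primesBelow, Real.log p / p := by
              rw [Finset.mul_sum]
              refine Finset.sum_le_sum fun p hp => ?_
              rw [Finset.mem_sdiff, Nat.mem_primesBelow, Nat.mem_primesBelow] at hp
              have hWp : W ≤ p := by
                by_contra hlt
                exact hp.2 ⟨not_le.1 hlt, hp.1.2⟩
              rw [mul_one_div]
              gcongr
          _ ≤ ∑ p ∈ (W ^ 2).primesBelow, Real.log p / p := by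
              refine Finset.sum_le_sum_of_subset_of_nonneg Finset.sdiff_subset fun p _ _ => ?_
              exact div_nonneg (Real.log_natCast_nonneg p) p.cast_nonneg
          _ ≤ Real.log (W ^ 2 : ℕ) + Real.log 4 := sum_log_div_primesBelow_le (by nlinarith)
          _ = 2 * Real.log W + 2 * Real.log 2 := by
              rw [show (4 : ℝ) = 2 ^ 2 by norm_num, Real.log_pow, Nat.cast_pow, Real.log_pow]
              norm_num
          _ ≤ Real.log W * 4 := by linarith
      exact le_of_mul_le_mul_left this hlW
    push_cast
    linarith

theorem sum_inv_primesBelow_le {w : ℕ} (hw : 2 ≤ w) :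
    ∑ p ∈ w.primesBelow, (1 : ℝ) / p ≤ 6 * Real.log (Real.log w) + 7 := by
  have hl2 : 0 < Real.log 2 := Real.log_pos (by norm_num)
  have hl2' := Real.log_two_gt_d9
  have hlw : Real.log 2 ≤ Real.log w := Real.log_le_log (by norm_num) (by exact_mod_cast hw)
  set t : ℝ := Real.log (Real.log w / Real.log 2) with ht
  have ht0 : 0 ≤ t := Real.log_nonneg ((one_le_div hl2).2 hlw)
  -- The least `j` with `2 ^ 2 ^ j ≥ w`, that is, the iterated base-2 logarithm of `w` rounded up.
  set j : ℕ := ⌈t / Real.log 2⌉₊ with hj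
  have hj1 : t / Real.log 2 ≤ j := Nat.le_ceil _
  have hj2 : (j : ℝ) < t / Real.log 2 + 1 := Nat.ceil_lt_add_one (by positivity)
  have hwj : w ≤ 2 ^ 2 ^ j := by
    have h1 : Real.log w / Real.log 2 ≤ (2 : ℝ) ^ j := by
      rw [← Real.log_le_log_iff (div_pos (hl2.trans_le hlw) hl2) (by positivity), Real.log_pow]
      rwa [div_le_iff₀ hl2] at hj1
    rw [div_le_iff₀ hl2] at h1
    have h2 : Real.log w ≤ Real.log ((2 : ℝ) ^ 2 ^ j) := by
      rw [Real.log_pow]; push_cast; exact h1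
    rw [Real.log_le_log_iff (by positivity) (by positivity)] at h2
    exact_mod_cast h2
  have hM := (sum_inv_primesBelow_mono hwj).trans (sum_inv_primesBelow_two_pow_two_pow_le j)
  have htt : t = Real.log (Real.log w) - Real.log (Real.log 2) :=
    Real.log_div (hl2.trans_le hlw).ne' hl2.ne'
  have hinv : (Real.log 2)⁻¹ ≤ 1.45 := by
    rw [inv_le_comm₀ hl2 (by norm_num)]
    norm_num at hl2' ⊢
    linarith
  have hll2 : -Real.log (Real.log 2) ≤ 0.45 := by
    rw [← Real.log_inv]
    linarith [Real.log_le_sub_one_of_pos (inv_pos.2 hl2)]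
  have : t / Real.log 2 ≤ 1.45 * t := by
    rw [div_eq_mul_inv, mul_comm]
    gcongr
  linarith

/-- The chord bound for the convex function `exp` between `0` and `σ log w`. The factor `log p / log
w` is what lets the sum of `log p / p` be used afterwards. -/
theorem rpow_le_one_add {w p : ℕ} (hp : 1 ≤ p) (hpw : p ≤ w) (hw : 2 ≤ w) (σ : ℝ) :
    (p : ℝ) ^ σ ≤ 1 + Real.log p / Real.log w * (w : ℝ) ^ σ := by
  have hlw : 0 < Real.log w := Real.log_pos (by exact_mod_cast hw)
  have hlp : 0 ≤ Real.log p := Real.log_natCast_nonneg p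
  have hpw' : Real.log p ≤ Real.log w :=
    Real.log_le_log (by exact_mod_cast hp) (by exact_mod_cast hpw)
  rw [Real.rpow_def_of_pos (by exact_mod_cast hp), Real.rpow_def_of_pos (by positivity)]
  set a := Real.log p / Real.log w
  have ha0 : 0 ≤ a := by positivity
  have ha1 : a ≤ 1 := (div_le_one hlw).2 hpw'
  have hc := convexOn_exp.2 (Set.mem_univ (Real.log w * σ)) (Set.mem_univ 0) ha0
    (sub_nonneg.2 ha1) (by ring)
  simp only [smul_eq_mul, mul_zero, add_zero, Real.exp_zero, mul_one] at hc
  have he : a * (Real.log w * σ) = Real.log p * σ := by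
    simp only [a]; field_simp
  rw [he] at hc
  linarith

theorem sum_rpow_sub_one_primesBelow_le {w : ℕ} (hw : 2 ≤ w) (σ : ℝ) :
    ∑ p ∈ w.primesBelow, (p : ℝ) ^ (σ - 1) ≤
      ∑ p ∈ w.primesBelow, (1 : ℝ) / p + 3 * (w : ℝ) ^ σ := by
  have hlw : 0 < Real.log w := Real.log_pos (by exact_mod_cast hw)
  have hlw2 : Real.log 2 ≤ Real.log w := Real.log_le_log (by norm_num) (by exact_mod_cast hw)
  have h1 : ∀ p ∈ w.primesBelow, (p : ℝ) ^ (σ - 1) ≤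
      (1 : ℝ) / p + (w : ℝ) ^ σ / Real.log w * (Real.log p / p) := by
    intro p hp
    rw [Nat.mem_primesBelow] at hp
    have hp0 : (0 : ℝ) < p := by exact_mod_cast hp.2.pos
    rw [Real.rpow_sub_one hp0.ne']
    calc (p : ℝ) ^ σ / p ≤ (1 + Real.log p / Real.log w * (w : ℝ) ^ σ) / p := by
          gcongr; exact rpow_le_one_add hp.2.one_le hp.1.le hw σ
      _ = _ := by ring
  refine (Finset.sum_le_sum h1).trans ?_
  rw [Finset.sum_add_distrib, ← Finset.mul_sum]
  refine add_le_add_right ?_ _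
  calc (w : ℝ) ^ σ / Real.log w * ∑ p ∈ w.primesBelow, Real.log p / p
      ≤ (w : ℝ) ^ σ / Real.log w * (3 * Real.log w) := by
        gcongr
        refine (sum_log_div_primesBelow_le hw).trans ?_
        rw [show (4 : ℝ) = 2 ^ 2 by norm_num, Real.log_pow]
        push_cast
        linarith
    _ = 3 * (w : ℝ) ^ σ := by field_simp

theorem sum_inv_sq_Ico_le {w N : ℕ} (hw : 1 ≤ w) :
    ∑ n ∈ Finset.Ico w N, (1 : ℝ) / (n : ℝ) ^ 2 ≤ 2 / w := by
  have hw0 : (0 : ℝ) < w := by exact_mod_cast hw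
  rcases le_total N w with h | h
  · rw [Finset.Ico_eq_empty_of_le h, Finset.sum_empty]; positivity
  have : ∑ n ∈ Finset.Ico w N, (1 : ℝ) / (n : ℝ) ^ 2 ≤ 2 / w - 2 / N := by
    induction N, h using Nat.le_induction with
    | base => simp
    | succ N hN ih =>
      rw [Finset.sum_Ico_succ_top hN]
      have hN1 : (1 : ℝ) ≤ N := by exact_mod_cast hw.trans hN
      have : (1 : ℝ) / (N : ℝ) ^ 2 ≤ 2 / N - 2 / (N + 1 : ℕ) := by
        push_cast
        rw [div_sub_div _ _ (by positivity) (by positivity), div_le_div_iff₀ (by positivity)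
          (by positivity)]
        nlinarith
      linarith
  exact this.trans (sub_le_self _ (by positivity))

/-! ### Euler products over smooth numbers and Rankin's bound -/

/-- The completely multiplicative function `n ↦ f(n) / n`, where `f` takes the values `a p` at the
primes `p`. -/
noncomputable def completelyMultiplicativeDiv (a : ℕ → ℝ) : ℕ →*₀ ℝ where
  toFun n := completelyMultiplicativeExt a n / n
  map_zero' := by simp
  map_one' := by simp [completelyMultiplicativeExt]
  map_mul' m n := by
    rcases eq_or_ne m 0 with rfl | hm
    · simp
    rcases eq_or_ne n 0 with rfl | hn
    · simp
    simp only [completelyMultiplicativeExt]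
    rw [Nat.factorization_mul hm hn, Finsupp.prod_add_index' (by simp) (by simp [pow_add]),
      Nat.cast_mul, mul_div_mul_comm]

theorem completelyMultiplicativeDiv_apply (a : ℕ → ℝ) (n : ℕ) :
    completelyMultiplicativeDiv a n = completelyMultiplicativeExt a n / n := rfl

theorem completelyMultiplicativeDiv_prime (a : ℕ → ℝ) {p : ℕ} (hp : p.Prime) :
    completelyMultiplicativeDiv a p = a p / p := by
  rw [completelyMultiplicativeDiv_apply, completelyMultiplicativeExt, hp.factorization,
    Finsupp.prod_single_index (by simp), pow_one]

theorem abs_completelyMultiplicativeDiv_le {a : ℕ → ℝ} (ha : ∀ p, |a p| ≤ 1) (n : ℕ) :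
    |completelyMultiplicativeDiv a n| ≤ 1 / n := by
  rw [completelyMultiplicativeDiv_apply, abs_div, Nat.abs_cast]
  gcongr
  rw [completelyMultiplicativeExt, Finsupp.prod, Finset.abs_prod]
  refine Finset.prod_le_one (fun _ _ => abs_nonneg _) fun p _ => ?_
  rw [abs_pow]
  exact pow_le_one₀ (abs_nonneg _) (ha p)

theorem abs_prime_lt_one {h : ℕ →*₀ ℝ} (hh : ∀ n : ℕ, |h n| ≤ 1 / n) {p : ℕ} (hp : p.Prime) :
    |h p| < 1 :=
  (hh p).trans_lt ((div_lt_one (by exact_mod_cast hp.pos)).2 (by exact_mod_cast hp.one_lt))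

theorem hasSum_indicator_smoothNumbers {h : ℕ →*₀ ℝ} (hh : ∀ p : ℕ, p.Prime → |h p| < 1) (w : ℕ) :
    HasSum (w.smoothNumbers.indicator h) (∏ p ∈ w.primesBelow, (1 - h p)⁻¹) := by
  have := (EulerProduct.summable_and_hasSum_smoothNumbers_prod_primesBelow_geometric
    (f := (h : ℕ →* ℝ)) (fun {p} hp => hh p hp) w).2
  exact hasSum_subtype_iff_indicator.1 this

/-- `n ↦ n ^ s` for `s ≠ 0`. -/
noncomputable def rpowHom (s : ℝ) (hs : s ≠ 0) : ℕ →*₀ ℝ where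
  toFun n := (n : ℝ) ^ s
  map_zero' := by simp [hs]
  map_one' := by simp
  map_mul' m n := by
    rw [Nat.cast_mul, Real.mul_rpow m.cast_nonneg n.cast_nonneg]

/-- The hypothesis says `1/(1 - t) ≤ c`, so `1/(1 - t) = 1 + t/(1 - t) ≤ 1 + ct ≤ exp(ct)`. -/
theorem prod_one_sub_inv_le_exp {ι : Type*} (s : Finset ι) {t : ι → ℝ} {c : ℝ} (hc : 1 ≤ c)
    (h0 : ∀ i ∈ s, 0 ≤ t i) (h1 : ∀ i ∈ s, t i ≤ 1 - c⁻¹) :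
    ∏ i ∈ s, (1 - t i)⁻¹ ≤ Real.exp (c * ∑ i ∈ s, t i) := by
  have hc0 : 0 < c := by linarith
  rw [Finset.mul_sum, Real.exp_sum]
  have hpos : ∀ i ∈ s, 0 < 1 - t i := fun i hi => by
    have := inv_pos.2 hc0
    linarith [h1 i hi]
  refine Finset.prod_le_prod (fun i hi => (inv_pos.2 (hpos i hi)).le) fun i hi => ?_
  refine le_trans ?_ (Real.add_one_le_exp _)
  rw [inv_le_iff_one_le_mul₀ (hpos i hi)]
  have h2 : c * t i ≤ c - 1 := by
    have := mul_le_mul_of_nonneg_left (h1 i hi) hc0.le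
    rwa [mul_sub, mul_inv_cancel₀ hc0.ne', mul_one] at this
  nlinarith [h0 i hi]

/-- Rankin's trick: for `n ≥ x`, `1/n ≤ x^(-σ) n^(σ-1)`, and the sum of `n^(σ-1)` over smooth `n` is
an Euler product. The condition `σ ≤ 1/2` keeps `p^(σ-1)` below `2^(-1/2) ≤ 3/4`, whence the factor
`4` in the exponent. -/
theorem abs_sum_smoothNumbers_sub_eulerProduct_le {h : ℕ →*₀ ℝ} (hh : ∀ n : ℕ, |h n| ≤ 1 / n)
    (w : ℕ) {x σ : ℝ} (hx : 0 < x) (hσ0 : 0 ≤ σ) (hσ : σ ≤ 1 / 2) :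
    |∑ n ∈ Finset.range (⌊x⌋₊ + 1), w.smoothNumbers.indicator h n -
        ∏ p ∈ w.primesBelow, (1 - h p)⁻¹| ≤
      x ^ (-σ) * Real.exp (4 * ∑ p ∈ w.primesBelow, (p : ℝ) ^ (σ - 1)) := by
  have hs : σ - 1 ≠ 0 := by linarith
  set G := rpowHom (σ - 1) hs with hG
  have hGn : ∀ n : ℕ, G n = (n : ℝ) ^ (σ - 1) := fun _ => rfl
  have hG0 : ∀ n : ℕ, 0 ≤ G n := fun n => by rw [hGn]; positivity
  have hGp : ∀ p : ℕ, p.Prime → G p ≤ 1 - (4 : ℝ)⁻¹ := by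
    intro p hp
    have hp2 : (2 : ℝ) ≤ p := by exact_mod_cast hp.two_le
    rw [hGn]
    calc (p : ℝ) ^ (σ - 1) ≤ (p : ℝ) ^ (-(1 / 2) : ℝ) :=
          Real.rpow_le_rpow_of_exponent_le (by linarith) (by linarith)
      _ ≤ (2 : ℝ) ^ (-(1 / 2) : ℝ) :=
          Real.rpow_le_rpow_of_nonpos (by norm_num) hp2 (by norm_num)
      _ ≤ 1 - (4 : ℝ)⁻¹ := by
          rw [Real.rpow_neg (by norm_num), ← Real.sqrt_eq_rpow, inv_le_comm₀ (by positivity)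
            (by norm_num)]
          exact Real.le_sqrt_of_sq_le (by norm_num)
  have hGs := hasSum_indicator_smoothNumbers (h := G)
    (fun p hp => by
      rw [abs_of_nonneg (hG0 p)]
      exact (hGp p hp).trans_lt (by norm_num)) w
  have hHs := hasSum_indicator_smoothNumbers (fun p hp => abs_prime_lt_one hh hp) w
  set N := ⌊x⌋₊ + 1 with hN
  set H := w.smoothNumbers.indicator h with hH
  have htail : ∑ n ∈ Finset.range N, H n - ∏ p ∈ w.primesBelow, (1 - h p)⁻¹ =
      -∑' n, H (n + N) := by
    rw [← hHs.tsum_eq, ← hHs.summable.sum_add_tsum_nat_add N]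
    ring
  rw [htail, abs_neg]
  have hb : ∀ n, |H (n + N)| ≤ x ^ (-σ) * w.smoothNumbers.indicator G (n + N) := by
    intro n
    by_cases hm : n + N ∈ w.smoothNumbers
    · rw [hH, Set.indicator_of_mem hm, Set.indicator_of_mem hm, hGn]
      refine (hh _).trans ?_
      have hxn : x ≤ (n + N : ℕ) := by
        have := Nat.lt_floor_add_one x
        push_cast
        rw [hN]
        push_cast
        linarith [(n.cast_nonneg : (0 : ℝ) ≤ n)]
      have hpos : (0 : ℝ) < (n + N : ℕ) := hx.trans_le hxn
      calc (1 : ℝ) / (n + N : ℕ) = ((n + N : ℕ) : ℝ) ^ (-σ) * ((n + N : ℕ) : ℝ) ^ (σ - 1) := by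
            rw [← Real.rpow_add hpos, neg_add_eq_sub, sub_sub_cancel_left, Real.rpow_neg_one,
              one_div]
        _ ≤ _ := by
            exact mul_le_mul_of_nonneg_right
              (Real.rpow_le_rpow_of_nonpos hx hxn (neg_nonpos.2 hσ0)) (by positivity)
    · rw [hH, Set.indicator_of_notMem hm, Set.indicator_of_notMem hm]
      simp
  have hGsum : Summable fun n => w.smoothNumbers.indicator G (n + N) :=
    (summable_nat_add_iff N).2 hGs.summable
  have hGle : ∑' n, w.smoothNumbers.indicator G (n + N) ≤
      ∏ p ∈ w.primesBelow, (1 - G p)⁻¹ := by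
    rw [← hGs.tsum_eq, ← hGs.summable.sum_add_tsum_nat_add N]
    exact le_add_of_nonneg_left
      (Finset.sum_nonneg fun n _ => Set.indicator_nonneg (fun n _ => hG0 n) n)
  have h1 := tsum_of_norm_bounded (f := fun n => H (n + N)) (hGsum.hasSum.mul_left (x ^ (-σ))) hb
  rw [Real.norm_eq_abs] at h1
  refine h1.trans ?_
  gcongr
  exact hGle.trans (prod_one_sub_inv_le_exp _ (by norm_num) (fun p _ => hG0 p)
    fun p hp => hGp p (Nat.prime_of_mem_primesBelow hp))

theorem prime_pos_one_sub {h : ℕ →*₀ ℝ} (hh : ∀ n : ℕ, |h n| ≤ 1 / n) {p : ℕ} (hp : p.Prime) :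
    0 < 1 - h p := by
  linarith [(abs_lt.1 (abs_prime_lt_one hh hp)).2]

theorem exp_neg_le_eulerProduct {h : ℕ →*₀ ℝ} (hh : ∀ n : ℕ, |h n| ≤ 1 / n) (w : ℕ) :
    Real.exp (-∑ p ∈ w.primesBelow, (1 : ℝ) / p) ≤ ∏ p ∈ w.primesBelow, (1 - h p)⁻¹ := by
  rw [← Finset.sum_neg_distrib, Real.exp_sum]
  refine Finset.prod_le_prod (fun _ _ => (Real.exp_pos _).le) fun p hp => ?_
  have hp' := prime_pos_one_sub hh (Nat.prime_of_mem_primesBelow hp)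
  rw [Real.exp_neg]
  refine inv_anti₀ hp' ?_
  linarith [Real.add_one_le_exp ((1 : ℝ) / p), (abs_le.1 (hh p)).1]

theorem eulerProduct_le_exp {h : ℕ →*₀ ℝ} (hh : ∀ n : ℕ, |h n| ≤ 1 / n) (w : ℕ) :
    ∏ p ∈ w.primesBelow, (1 - h p)⁻¹ ≤ Real.exp (2 * ∑ p ∈ w.primesBelow, (1 : ℝ) / p) := by
  have hp2 : ∀ p ∈ w.primesBelow, (1 : ℝ) / p ≤ 1 - (2 : ℝ)⁻¹ := fun p hp => by
    have : (2 : ℝ) ≤ p := by exact_mod_cast (Nat.prime_of_mem_primesBelow hp).two_le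
    rw [div_le_iff₀ (by linarith)]
    linarith
  refine le_trans ?_ (prod_one_sub_inv_le_exp _ one_le_two (fun p _ => by positivity) hp2)
  refine Finset.prod_le_prod (fun p hp => (inv_pos.2
    (prime_pos_one_sub hh (Nat.prime_of_mem_primesBelow hp))).le) fun p hp => ?_
  refine inv_anti₀ (by linarith [hp2 p hp]) ?_
  linarith [(abs_le.1 (hh p)).2]

theorem inv_one_sub_le_exp {t : ℝ} (ht : |t| ≤ 1 / 2) : (1 - t)⁻¹ ≤ Real.exp (t + t ^ 2) := by
  obtain ⟨h1, h2⟩ := abs_le.1 ht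
  have hpos : 0 < 1 - t := by linarith
  rw [inv_le_iff_one_le_mul₀ hpos]
  rcases le_total 0 t with h0 | h0
  · have hq := Real.quadratic_le_exp_of_nonneg (x := t + t ^ 2) (by positivity)
    have h3 : 1 ≤ (1 - t) * (1 + (t + t ^ 2) + (t + t ^ 2) ^ 2 / 2) := by
      have : (1 - t) * (1 + (t + t ^ 2) + (t + t ^ 2) ^ 2 / 2) - 1 =
          t ^ 2 * ((1 - 2 * t) + t * (1 - t - t ^ 2)) / 2 := by ring
      have h4 : 0 ≤ t * (1 - t - t ^ 2) := mul_nonneg h0 (by nlinarith)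
      have : 0 ≤ t ^ 2 * ((1 - 2 * t) + t * (1 - t - t ^ 2)) / 2 := by
        have : 0 ≤ 1 - 2 * t := by linarith
        positivity
      linarith
    nlinarith
  · have hq := Real.add_one_le_exp (t + t ^ 2)
    have h3 : 1 ≤ (1 - t) * (t + t ^ 2 + 1) := by
      have : 0 ≤ -t * t ^ 2 := mul_nonneg (by linarith) (by positivity)
      nlinarith
    nlinarith

/-- With `T = ∑ t`, `D = ∑ t^2` and `W = |T| + D`, the product lies between `exp T` and `exp(T +
D)`, so its distance from `1` is at most `exp W - 1`. Bernoulli's inequality `m(exp W - 1) ≤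
exp(mW)` then buys a saving `1/m` at the price of an exponential moment. -/
theorem abs_prod_inv_one_sub_sub_one_le {ι : Type*} (s : Finset ι) {t : ι → ℝ}
    (ht : ∀ i ∈ s, |t i| ≤ 1 / 2) {m : ℕ} (hm : 0 < m) :
    |∏ i ∈ s, (1 - t i)⁻¹ - 1| ≤
      Real.exp (m * (|∑ i ∈ s, t i| + ∑ i ∈ s, t i ^ 2)) / m := by
  set R := ∏ i ∈ s, (1 - t i)⁻¹
  set T := ∑ i ∈ s, t i
  set D := ∑ i ∈ s, t i ^ 2
  have hD : 0 ≤ D := Finset.sum_nonneg fun i _ => sq_nonneg _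
  have hm0 : (0 : ℝ) < m := by exact_mod_cast hm
  have hpos : ∀ i ∈ s, 0 < 1 - t i := fun i hi => by linarith [(abs_le.1 (ht i hi)).2]
  have hub : R ≤ Real.exp (T + D) := by
    rw [← Finset.sum_add_distrib, Real.exp_sum]
    exact Finset.prod_le_prod (fun i hi => (inv_pos.2 (hpos i hi)).le)
      fun i hi => inv_one_sub_le_exp (ht i hi)
  have hlb : Real.exp T ≤ R := by
    rw [Real.exp_sum]
    refine Finset.prod_le_prod (fun i hi => (Real.exp_pos _).le) fun i hi => ?_
    rw [le_inv_comm₀ (Real.exp_pos _) (hpos i hi), ← Real.exp_neg]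
    linarith [Real.add_one_le_exp (-t i)]
  set W := |T| + D
  have hW : |R - 1| ≤ Real.exp W - 1 := by
    have hWexp := Real.add_one_le_exp W
    have : Real.exp (T + D) ≤ Real.exp W := Real.exp_le_exp.2 (by linarith [le_abs_self T])
    have := Real.add_one_le_exp T
    have := neg_abs_le T
    exact abs_le.2 ⟨by linarith, by linarith⟩
  refine hW.trans ?_
  rw [le_div_iff₀ hm0, Real.exp_nat_mul]
  have := one_add_mul_le_pow (a := Real.exp W - 1) (by linarith [Real.exp_pos W]) m
  rw [add_sub_cancel] at this
  linarith

theorem IsRademacherOnPrimes.measurable_completelyMultiplicativeDiv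
    {Ω : Type*} [MeasurableSpace Ω] {P : Measure Ω} {Y : ℕ → Ω → ℝ}
    (hY : IsRademacherOnPrimes P Y) (n : ℕ) :
    Measurable fun ω => completelyMultiplicativeDiv (fun p => Y p ω) n := by
  simp only [completelyMultiplicativeDiv_apply, completelyMultiplicativeExt, Finsupp.prod]
  refine Measurable.div_const (Finset.measurable_fun_prod _ fun p hp => ?_) _
  rw [Nat.support_factorization] at hp
  exact (hY.measurable p (Nat.prime_of_mem_primeFactors hp)).pow_const _

/-! ### Nonnegativity, monotonicity and sub-Gaussian bounds for moments -/

section Moments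

variable {Ω : Type*} [MeasurableSpace Ω] {P : Measure Ω} [IsProbabilityMeasure P]

theorem integrable_of_measurable_of_abs_le {f : Ω → ℝ} (hf : Measurable f) {C : ℝ}
    (hC : ∀ ω, |f ω| ≤ C) : Integrable f P :=
  Integrable.of_bound hf.aestronglyMeasurable C (Filter.Eventually.of_forall hC)

/-- Expanding the power gives a sum of expectations `E g(m n₁ ⋯ n_k) ≥ 0`, with more terms for
larger sets. The extra factor `g m` makes the induction close: multiplicativity absorbs one factor
`g j` into it. -/
theorem integral_mul_sum_pow_mono {g : Ω → ℕ →*₀ ℝ} (hmeas : ∀ n, Measurable fun ω => g ω n)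
    (hbound : ∀ ω n, |g ω n| ≤ 1) (hnonneg : ∀ n, 0 ≤ ∫ ω, g ω n ∂P)
    {S T : Finset ℕ} (hST : S ⊆ T) (k m : ℕ) :
    0 ≤ ∫ ω, g ω m * (∑ n ∈ S, g ω n) ^ k ∂P ∧
      ∫ ω, g ω m * (∑ n ∈ S, g ω n) ^ k ∂P ≤ ∫ ω, g ω m * (∑ n ∈ T, g ω n) ^ k ∂P := by
  have hint : ∀ (U : Finset ℕ) (k m : ℕ),
      Integrable (fun ω => g ω m * (∑ n ∈ U, g ω n) ^ k) P := by
    intro U k m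
    refine integrable_of_measurable_of_abs_le (C := 1 * (U.card : ℝ) ^ k) ?_ fun ω => ?_
    · exact (hmeas m).mul ((Finset.measurable_fun_sum U fun n _ => hmeas n).pow_const k)
    · rw [abs_mul, abs_pow]
      gcongr
      · exact hbound ω m
      · refine (Finset.abs_sum_le_sum_abs _ _).trans ?_
        refine (Finset.sum_le_card_nsmul U _ 1 fun n _ => hbound ω n).trans ?_
        simp
  have hsucc : ∀ (U : Finset ℕ) (k m : ℕ), ∫ ω, g ω m * (∑ n ∈ U, g ω n) ^ (k + 1) ∂P =
      ∑ j ∈ U, ∫ ω, g ω (m * j) * (∑ n ∈ U, g ω n) ^ k ∂P := by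
    intro U k m
    rw [← integral_finsetSum _ fun j _ => hint U k (m * j)]
    congr 1 with ω
    rw [pow_succ', Finset.sum_mul, Finset.mul_sum]
    refine Finset.sum_congr rfl fun j _ => ?_
    rw [map_mul]
    ring
  induction k generalizing m with
  | zero => simpa using hnonneg m
  | succ k ih =>
    rw [hsucc, hsucc]
    refine ⟨Finset.sum_nonneg fun j _ => (ih (m * j)).1, ?_⟩
    calc _ ≤ ∑ j ∈ S, ∫ ω, g ω (m * j) * (∑ n ∈ T, g ω n) ^ k ∂P :=
          Finset.sum_le_sum fun j _ => (ih (m * j)).2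
      _ ≤ _ := Finset.sum_le_sum_of_subset_of_nonneg hST fun j _ _ =>
          (ih (m * j)).1.trans (ih (m * j)).2

theorem integral_sum_pow_mono {g : Ω → ℕ →*₀ ℝ} (hmeas : ∀ n, Measurable fun ω => g ω n)
    (hbound : ∀ ω n, |g ω n| ≤ 1) (hnonneg : ∀ n, 0 ≤ ∫ ω, g ω n ∂P)
    {S T : Finset ℕ} (hST : S ⊆ T) (k : ℕ) :
    ∫ ω, (∑ n ∈ S, g ω n) ^ k ∂P ≤ ∫ ω, (∑ n ∈ T, g ω n) ^ k ∂P := by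
  simpa using (integral_mul_sum_pow_mono hmeas hbound hnonneg hST k 1).2

variable {Y : ℕ → Ω → ℝ}

theorem IsRademacherOnPrimes.integral_eq_zero (hY : IsRademacherOnPrimes P Y)
    (hsign : ∀ n ω, Y n ω = 1 ∨ Y n ω = -1) {p : ℕ} (hp : p.Prime) : ∫ ω, Y p ω ∂P = 0 := by
  have h1 : MeasurableSet {ω | Y p ω = 1} := hY.measurable p hp (measurableSet_singleton 1)
  have h2 : MeasurableSet {ω | Y p ω = -1} := hY.measurable p hp (measurableSet_singleton (-1))
  have : Y p = fun ω => {ω | Y p ω = 1}.indicator 1 ω - {ω | Y p ω = -1}.indicator 1 ω := by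
    ext ω
    rcases hsign p ω with h | h <;> norm_num [Set.indicator, h]
  rw [this, integral_sub, integral_indicator_one h1, integral_indicator_one h2,
    hY.prob_one p hp, hY.prob_neg_one p hp, sub_self]
  · exact (integrable_const (1 : ℝ)).indicator h1
  · exact (integrable_const (1 : ℝ)).indicator h2

theorem IsRademacherOnPrimes.integral_pow_nonneg (hY : IsRademacherOnPrimes P Y)
    (hsign : ∀ n ω, Y n ω = 1 ∨ Y n ω = -1) {p : ℕ} (hp : p.Prime) (k : ℕ) :
    0 ≤ ∫ ω, Y p ω ^ k ∂P := by
  rcases Nat.even_or_odd k with hk | hk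
  · exact integral_nonneg fun ω => hk.pow_nonneg _
  · have : ∀ ω, Y p ω ^ k = Y p ω := fun ω => by
      rcases hsign p ω with h | h <;> simp [h, hk.neg_one_pow]
    simp_rw [this]
    exact (hY.integral_eq_zero hsign hp).ge

theorem IsRademacherOnPrimes.integral_completelyMultiplicativeDiv_nonneg
    (hY : IsRademacherOnPrimes P Y) (hsign : ∀ n ω, Y n ω = 1 ∨ Y n ω = -1) (n : ℕ) :
    0 ≤ ∫ ω, completelyMultiplicativeDiv (fun p => Y p ω) n ∂P := by
  simp only [completelyMultiplicativeDiv_apply, completelyMultiplicativeExt, Finsupp.prod]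
  rw [integral_div, Nat.support_factorization]
  refine div_nonneg ?_ n.cast_nonneg
  let e : n.primeFactors → Nat.Primes := fun p => ⟨p, Nat.prime_of_mem_primeFactors p.2⟩
  have he : e.Injective := fun a b hab => Subtype.ext (congrArg (fun p : Nat.Primes => (p : ℕ)) hab)
  have hind := hY.indep.precomp he
  simp_rw [← Finset.prod_coe_sort n.primeFactors]
  have hprod := iIndepFun.integral_fun_prod_comp (X := fun i : n.primeFactors => Y (i : ℕ))
    (f := fun i t => t ^ n.factorization i) hind
    (fun i => (hY.measurable i (Nat.prime_of_mem_primeFactors i.2)).aemeasurable)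
    (fun i => (measurable_id.pow_const _).aestronglyMeasurable)
  rw [show (∫ ω, ∏ i : n.primeFactors, Y i ω ^ n.factorization i ∂P) = _ from hprod]
  exact Finset.prod_nonneg fun i _ =>
    hY.integral_pow_nonneg hsign (Nat.prime_of_mem_primeFactors i.2) _

/-- Hoeffding's lemma gives each `Y p / p` variance proxy `1/p^2`, and independence adds the
proxies. The factor `2` comes from `exp(r|T|) ≤ exp(rT) + exp(-rT)`. -/
theorem IsRademacherOnPrimes.integral_exp_abs_sum_le (hY : IsRademacherOnPrimes P Y)
    (hsign : ∀ n ω, Y n ω = 1 ∨ Y n ω = -1) {s : Finset ℕ} (hs : ∀ p ∈ s, p.Prime) (r : ℝ) :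
    Integrable (fun ω => Real.exp (r * |∑ p ∈ s, Y p ω / p|)) P ∧
    ∫ ω, Real.exp (r * |∑ p ∈ s, Y p ω / p|) ∂P ≤
      2 * Real.exp ((∑ p ∈ s, 1 / (p : ℝ) ^ 2) * r ^ 2 / 2) := by
  have hmeas : ∀ p ∈ s, Measurable fun ω => Y p ω / p := fun p hp =>
    (hY.measurable p (hs p hp)).div_const _
  have hTm : Measurable fun ω => ∑ p ∈ s, Y p ω / p := Finset.measurable_fun_sum s hmeas
  have hind : iIndepFun (fun (p : Nat.Primes) ω => Y p ω / p) P :=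
    hY.indep.comp (fun p t => t / p) fun p => measurable_id.div_const _
  have hsub : ∀ p ∈ s.subtype Nat.Prime, HasSubgaussianMGF (fun ω => Y (p : ℕ) ω / (p : ℕ))
      ((‖(1 / (p : ℕ) : ℝ) - -(1 / (p : ℕ))‖₊ / 2) ^ 2) P := by
    intro p _
    refine hasSubgaussianMGF_of_mem_Icc_of_integral_eq_zero
      ((hY.measurable p p.2).div_const _).aemeasurable
      (Filter.Eventually.of_forall fun ω => ?_) ?_
    · have : (0 : ℝ) ≤ 1 / (p : ℕ) := by positivity
      rcases hsign p ω with h | h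
      · exact ⟨by rw [h]; linarith, by rw [h]⟩
      · exact ⟨by rw [h, neg_div], by rw [h, neg_div]; linarith⟩
    · rw [integral_div, hY.integral_eq_zero hsign p.2, zero_div]
  have hT := HasSubgaussianMGF.sum_of_iIndepFun hind hsub
  have hTeq : (fun ω => ∑ p ∈ s.subtype Nat.Prime, Y (p : ℕ) ω / (p : ℕ)) =
      fun ω => ∑ p ∈ s, Y p ω / p := by
    ext ω
    exact Finset.sum_subtype_of_mem (fun p : ℕ => Y p ω / p) hs
  have hc : ((∑ p ∈ s.subtype Nat.Prime,
      (‖(1 / (p : ℕ) : ℝ) - -(1 / (p : ℕ))‖₊ / 2) ^ 2 : NNReal) : ℝ) =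
      ∑ p ∈ s, 1 / (p : ℝ) ^ 2 := by
    rw [← Finset.sum_subtype_of_mem (fun p : ℕ => 1 / (p : ℝ) ^ 2) hs]
    push_cast
    refine Finset.sum_congr rfl fun p _ => ?_
    rw [sub_neg_eq_add, Real.norm_of_nonneg (by positivity)]
    ring
  have hmgf : ∀ t, mgf (fun ω => ∑ p ∈ s, Y p ω / p) P t ≤
      Real.exp ((∑ p ∈ s, 1 / (p : ℝ) ^ 2) * t ^ 2 / 2) := by
    intro t
    refine ((congrArg (fun F => mgf F P t) hTeq).symm.le.trans (hT.mgf_le t)).trans_eq ?_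
    exact congrArg (fun c : ℝ => Real.exp (c * t ^ 2 / 2)) hc
  have hint : ∀ t, Integrable (fun ω => Real.exp (t * ∑ p ∈ s, Y p ω / p)) P := by
    intro t
    exact (hT.integrable_exp_mul t).congr (Filter.Eventually.of_forall fun ω =>
      congrArg (fun z => Real.exp (t * z)) (congrFun hTeq ω))
  have hle : ∀ ω, Real.exp (r * |∑ p ∈ s, Y p ω / p|) ≤
      Real.exp (r * ∑ p ∈ s, Y p ω / p) + Real.exp (-r * ∑ p ∈ s, Y p ω / p) := by
    intro ω
    rcases abs_cases (∑ p ∈ s, Y p ω / p) with ⟨h, _⟩ | ⟨h, _⟩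
    · rw [h]; linarith [Real.exp_pos (-r * ∑ p ∈ s, Y p ω / p)]
    · rw [h, mul_neg, ← neg_mul]; linarith [Real.exp_pos (r * ∑ p ∈ s, Y p ω / p)]
  have hint2 : Integrable (fun ω => Real.exp (r * |∑ p ∈ s, Y p ω / p|)) P := by
    refine ((hint r).add (hint (-r))).mono' ?_ (Filter.Eventually.of_forall fun ω => ?_)
    · exact (Real.measurable_exp.comp (hTm.abs.const_mul r)).aestronglyMeasurable
    · rw [Real.norm_of_nonneg (Real.exp_pos _).le]
      exact hle ω
  refine ⟨hint2, ?_⟩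
  calc _ ≤ ∫ ω, (Real.exp (r * ∑ p ∈ s, Y p ω / p) + Real.exp (-r * ∑ p ∈ s, Y p ω / p)) ∂P :=
        integral_mono hint2 ((hint r).add (hint (-r))) hle
    _ = mgf (fun ω => ∑ p ∈ s, Y p ω / p) P r + mgf (fun ω => ∑ p ∈ s, Y p ω / p) P (-r) :=
        integral_add (hint r) (hint (-r))
    _ ≤ _ := by
        have h1 := hmgf r
        have h2 := hmgf (-r)
        rw [neg_sq] at h2
        linarith

end Moments

/-! ### The high moment of the non-smooth part -/

theorem sum_inv_sq_primesBelow_sdiff_le {w : ℕ} (hw : 1 ≤ w) (N : ℕ) :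
    ∑ p ∈ N.primesBelow \ w.primesBelow, (1 : ℝ) / (p : ℝ) ^ 2 ≤ 2 / w := by
  refine le_trans ?_ (sum_inv_sq_Ico_le (N := N) hw)
  refine Finset.sum_le_sum_of_subset_of_nonneg ?_ fun _ _ _ => by positivity
  intro p hp
  rw [Finset.mem_sdiff, Nat.mem_primesBelow, Nat.mem_primesBelow] at hp
  exact Finset.mem_Ico.2 ⟨not_lt.1 fun h => hp.2 ⟨h, hp.1.2⟩, hp.1.1⟩

theorem prime_of_mem_primesBelow_sdiff {w N p : ℕ} (hp : p ∈ N.primesBelow \ w.primesBelow) :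
    p.Prime :=
  Nat.prime_of_mem_primesBelow (Finset.mem_sdiff.1 hp).1

theorem abs_le_one_of_sign {y : ℝ} (h : y = 1 ∨ y = -1) : |y| ≤ 1 := by
  rcases h with h | h <;> simp [h]

section

variable {Ω : Type*} [MeasurableSpace Ω] {P : Measure Ω} [IsProbabilityMeasure P] {Y : ℕ → Ω → ℝ}

theorem IsRademacherOnPrimes.integral_roughProduct_sub_one_pow_le (hY : IsRademacherOnPrimes P Y)
    (hsign : ∀ n ω, Y n ω = 1 ∨ Y n ω = -1) {k : ℕ} (hk : 0 < k) (N : ℕ) :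
    Integrable (fun ω => (∏ p ∈ N.primesBelow \ Nat.primesBelow ((2 * k) ^ 4),
        (1 - completelyMultiplicativeDiv (fun p => Y p ω) p)⁻¹ - 1) ^ (2 * k)) P ∧
    ∫ ω, (∏ p ∈ N.primesBelow \ Nat.primesBelow ((2 * k) ^ 4),
        (1 - completelyMultiplicativeDiv (fun p => Y p ω) p)⁻¹ - 1) ^ (2 * k) ∂P ≤
      2 * Real.exp 3 / (2 * k) ^ (2 * k) := by
  set w : ℕ := (2 * k) ^ 4 with hw
  set s := N.primesBelow \ w.primesBelow with hs
  set D := ∑ p ∈ s, 1 / (p : ℝ) ^ 2 with hD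
  -- Taking `m = 2k` in the Bernoulli bound and raising to the power `2k` produces the exponent
  -- `(2k)^2`. The choice `w = (2k)^4 = r^2` makes `D r^2 ≤ 2`, so the exponential moment is
  -- bounded.
  set r : ℝ := 4 * k ^ 2 with hr
  have hk1 : (1 : ℝ) ≤ k := by exact_mod_cast hk
  have hwr : (w : ℝ) = r ^ 2 := by rw [hw, hr]; push_cast; ring
  have hr1 : 1 ≤ r := by rw [hr]; nlinarith
  have hDle : D ≤ 2 / r ^ 2 := by
    rw [← hwr]
    exact sum_inv_sq_primesBelow_sdiff_le (Nat.one_le_pow _ _ (by omega)) N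
  have hDr : D * r ^ 2 ≤ 2 := by rwa [le_div_iff₀ (by positivity)] at hDle
  have hD0 : 0 ≤ D := Finset.sum_nonneg fun _ _ => by positivity
  have hDr1 : r * D ≤ 2 := by nlinarith [mul_nonneg hD0 (by linarith : 0 ≤ r - 1)]
  obtain ⟨hint, hexp⟩ := hY.integral_exp_abs_sum_le hsign
    (s := s) (fun p hp => prime_of_mem_primesBelow_sdiff hp) r
  have hpt : ∀ ω, (∏ p ∈ s, (1 - completelyMultiplicativeDiv (fun p => Y p ω) p)⁻¹ - 1) ^ (2 * k) ≤
      Real.exp 2 / (2 * k) ^ (2 * k) * Real.exp (r * |∑ p ∈ s, Y p ω / p|) := by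
    intro ω
    have h1 : ∏ p ∈ s, (1 - completelyMultiplicativeDiv (fun p => Y p ω) p)⁻¹ =
        ∏ p ∈ s, (1 - Y p ω / p)⁻¹ := Finset.prod_congr rfl fun p hp => by
      rw [completelyMultiplicativeDiv_prime _ (prime_of_mem_primesBelow_sdiff hp)]
    have hsq : ∑ p ∈ s, (Y p ω / p) ^ 2 = D := Finset.sum_congr rfl fun p _ => by
      rcases hsign p ω with h | h <;> simp [h, div_pow]
    have h2 := abs_prod_inv_one_sub_sub_one_le s (t := fun p => Y p ω / p) (fun p hp => by
      have hp2 : (2 : ℝ) ≤ p := by exact_mod_cast (prime_of_mem_primesBelow_sdiff hp).two_le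
      rw [abs_div, Nat.abs_cast]
      exact div_le_div₀ zero_le_one (abs_le_one_of_sign (hsign p ω)) two_pos hp2)
      (m := 2 * k) (by omega)
    rw [h1, ← (even_two_mul k).pow_abs]
    rw [hsq] at h2
    refine (pow_le_pow_left₀ (abs_nonneg _) h2 _).trans ?_
    rw [div_pow, ← Real.exp_nat_mul, div_mul_eq_mul_div, ← Real.exp_add]
    push_cast
    gcongr
    have : (2 * k : ℝ) * (2 * k * (|∑ p ∈ s, Y p ω / p| + D)) =
        r * |∑ p ∈ s, Y p ω / p| + r * D := by rw [hr]; ring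
    linarith
  have hmeas : Measurable fun ω =>
      (∏ p ∈ s, (1 - completelyMultiplicativeDiv (fun p => Y p ω) p)⁻¹ - 1) ^ (2 * k) :=
    ((Finset.measurable_fun_prod _ fun p _ =>
      ((hY.measurable_completelyMultiplicativeDiv p).const_sub 1).inv).sub_const 1).pow_const _
  refine ⟨(hint.const_mul (Real.exp 2 / (2 * k) ^ (2 * k))).mono' hmeas.aestronglyMeasurable
    (Filter.Eventually.of_forall fun ω => ?_), ?_⟩
  · rw [Real.norm_of_nonneg ((even_two_mul k).pow_nonneg _)]
    exact hpt ω
  calc _ ≤ ∫ ω, Real.exp 2 / (2 * k) ^ (2 * k) * Real.exp (r * |∑ p ∈ s, Y p ω / p|) ∂P :=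
        integral_mono_of_nonneg
          (Filter.Eventually.of_forall fun ω => (even_two_mul k).pow_nonneg _)
          (hint.const_mul _) (Filter.Eventually.of_forall hpt)
    _ ≤ Real.exp 2 / (2 * k) ^ (2 * k) * (2 * Real.exp 1) := by
        rw [integral_const_mul]
        gcongr
        refine hexp.trans ?_
        gcongr
        linarith
    _ = _ := by
        rw [show (3 : ℝ) = 2 + 1 by norm_num, Real.exp_add]
        ring

/-- The moment of the sum over `n < N` is at most that over `n < m` for every `m ≥ N`. As `m → ∞`
the sum converges to a difference of two Euler products, dominated by the convergent sum of `1/n`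
over `N`-smooth `n`. -/
theorem IsRademacherOnPrimes.integral_sum_nonsmooth_pow_le (hY : IsRademacherOnPrimes P Y)
    (hsign : ∀ n ω, Y n ω = 1 ∨ Y n ω = -1) {k : ℕ} (hk : 0 < k) {N : ℕ}
    (hN : (2 * k) ^ 4 ≤ N) :
    ∫ ω, (∑ n ∈ Finset.range N, (N.smoothNumbers \ Nat.smoothNumbers ((2 * k) ^ 4)).indicator
        (completelyMultiplicativeDiv fun p => Y p ω) n) ^ (2 * k) ∂P ≤
      Real.exp (2 * ∑ p ∈ Nat.primesBelow ((2 * k) ^ 4), (1 : ℝ) / p) ^ (2 * k) *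
        (2 * Real.exp 3 / (2 * k) ^ (2 * k)) := by
  set w : ℕ := (2 * k) ^ 4 with hw
  set A := Real.exp (2 * ∑ p ∈ w.primesBelow, (1 : ℝ) / p) with hA
  set S : Set ℕ := N.smoothNumbers \ w.smoothNumbers with hS
  set h : Ω → ℕ →*₀ ℝ := fun ω => completelyMultiplicativeDiv (fun p => Y p ω) with hh
  have hbd : ∀ ω n, |h ω n| ≤ 1 / n := fun ω n =>
    abs_completelyMultiplicativeDiv_le (fun p => abs_le_one_of_sign (hsign p ω)) n
  have hbd1 : ∀ ω n, |h ω n| ≤ 1 := fun ω n => (hbd ω n).trans (by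
    rcases Nat.eq_zero_or_pos n with rfl | hn
    · simp
    · rw [div_le_one (by exact_mod_cast hn)]; exact_mod_cast hn)
  have hm : ∀ n, Measurable fun ω => h ω n := hY.measurable_completelyMultiplicativeDiv
  have hsub : w.primesBelow ⊆ N.primesBelow := by
    intro p hp
    rw [Nat.mem_primesBelow] at hp ⊢
    exact ⟨hp.1.trans_le hN, hp.2⟩
  have hsum : ∀ ω, HasSum (S.indicator (h ω))
      ((∏ p ∈ w.primesBelow, (1 - h ω p)⁻¹) *
        (∏ p ∈ N.primesBelow \ w.primesBelow, (1 - h ω p)⁻¹ - 1)) := by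
    intro ω
    have hlt : ∀ p : ℕ, p.Prime → |h ω p| < 1 := fun p hp => abs_prime_lt_one (hbd ω) hp
    have h1 := (hasSum_indicator_smoothNumbers hlt N).sub (hasSum_indicator_smoothNumbers hlt w)
    rw [← Finset.prod_sdiff hsub] at h1
    convert! h1 using 1
    · exact Set.indicator_sdiff (Nat.smoothNumbers_mono hN) _
    · ring
  have hone := (hasSum_indicator_smoothNumbers (h := completelyMultiplicativeDiv 1)
    (fun p hp => abs_prime_lt_one (abs_completelyMultiplicativeDiv_le (by simp)) hp) N).summable
  have habs : ∀ ω n, |S.indicator (h ω) n| ≤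
      N.smoothNumbers.indicator (completelyMultiplicativeDiv 1) n := by
    intro ω n
    have h1 : completelyMultiplicativeDiv 1 n = 1 / n := by
      rw [completelyMultiplicativeDiv_apply, completelyMultiplicativeExt]
      simp [Finsupp.prod]
    by_cases hn : n ∈ S
    · rw [Set.indicator_of_mem hn, Set.indicator_of_mem hn.1, h1]
      exact hbd ω n
    · rw [Set.indicator_of_notMem hn, abs_zero]
      refine Set.indicator_nonneg (fun n _ => ?_) n
      rw [completelyMultiplicativeDiv_apply, completelyMultiplicativeExt]
      simp only [Finsupp.prod, Pi.one_apply, one_pow, Finset.prod_const_one]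
      positivity
  classical
  set Z : ℕ → Ω → ℝ := fun m ω => ∑ n ∈ Finset.range m with n ∈ S, h ω n with hZ
  have hZind : ∀ m ω, Z m ω = ∑ n ∈ Finset.range m, S.indicator (h ω) n := by
    intro m ω
    simp only [hZ, Finset.sum_filter]
    exact Finset.sum_congr rfl fun n _ => by rw [Set.indicator_apply]
  have hZm : ∀ m, Measurable (Z m) := fun m => Finset.measurable_fun_sum _ fun n _ => hm n
  have hlim : Filter.Tendsto (fun m => ∫ ω, Z m ω ^ (2 * k) ∂P) Filter.atTop
      (nhds (∫ ω, ((∏ p ∈ w.primesBelow, (1 - h ω p)⁻¹) *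
        (∏ p ∈ N.primesBelow \ w.primesBelow, (1 - h ω p)⁻¹ - 1)) ^ (2 * k) ∂P)) := by
    refine tendsto_integral_of_dominated_convergence
      (fun _ => (∑' n, N.smoothNumbers.indicator (completelyMultiplicativeDiv 1) n) ^ (2 * k))
      (fun m => ((hZm m).pow_const _).aestronglyMeasurable) (integrable_const _)
      (fun m => Filter.Eventually.of_forall fun ω => ?_) (Filter.Eventually.of_forall fun ω => ?_)
    · rw [norm_pow, Real.norm_eq_abs, hZind]
      refine pow_le_pow_left₀ (abs_nonneg _) ?_ _
      refine (Finset.abs_sum_le_sum_abs _ _).trans ?_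
      refine (Finset.sum_le_sum fun n _ => habs ω n).trans ?_
      exact hone.sum_le_tsum _ fun n _ => (abs_nonneg _).trans (habs ω n)
    · simp_rw [hZind]
      exact (hsum ω).tendsto_sum_nat.pow _
  have hle : ∀ᶠ m in Filter.atTop, ∫ ω, Z N ω ^ (2 * k) ∂P ≤ ∫ ω, Z m ω ^ (2 * k) ∂P := by
    filter_upwards [Filter.eventually_ge_atTop N] with m hmN
    refine integral_sum_pow_mono hm hbd1
      (hY.integral_completelyMultiplicativeDiv_nonneg hsign) ?_ _
    exact Finset.filter_subset_filter _ (Finset.range_mono hmN)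
  have hmain := ge_of_tendsto hlim hle
  obtain ⟨hrint, hrle⟩ := hY.integral_roughProduct_sub_one_pow_le hsign hk N
  refine le_trans (le_of_eq ?_) (hmain.trans ?_)
  · congr 1 with ω
    rw [hZind]
  calc _ ≤ ∫ ω, A ^ (2 * k) *
        (∏ p ∈ N.primesBelow \ w.primesBelow, (1 - h ω p)⁻¹ - 1) ^ (2 * k) ∂P := by
        refine integral_mono_of_nonneg
          (Filter.Eventually.of_forall fun ω => (even_two_mul k).pow_nonneg _)
          (hrint.const_mul _) (Filter.Eventually.of_forall fun ω => ?_)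
        simp only [mul_pow]
        refine mul_le_mul_of_nonneg_right ?_ ((even_two_mul k).pow_nonneg _)
        refine pow_le_pow_left₀ ?_ (eulerProduct_le_exp (hbd ω) w) _
        exact (Real.exp_pos _).le.trans (exp_neg_le_eulerProduct (hbd ω) w)
    _ ≤ _ := by
        rw [integral_const_mul]
        exact mul_le_mul_of_nonneg_left hrle (by positivity)

end

/-! ### From the moment bound to the probability -/

section

variable {Ω : Type*} [MeasurableSpace Ω] {P : Measure Ω} [IsProbabilityMeasure P]

theorem IsRademacherOnPrimes.prob_sum_neg_le_of_sign {Y : ℕ → Ω → ℝ}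
    (hY : IsRademacherOnPrimes P Y)
    (hsign : ∀ n ω, Y n ω = 1 ∨ Y n ω = -1) {k : ℕ} (hk : 0 < k) {x σ M : ℝ} (hx : 0 < x)
    (hkx : (2 * k) ^ 4 ≤ ⌊x⌋₊ + 1) (hσ0 : 0 ≤ σ) (hσ : σ ≤ 1 / 2)
    (hM : ∑ p ∈ Nat.primesBelow ((2 * k) ^ 4), (1 : ℝ) / p ≤ M)
    (htail : x ^ (-σ) * Real.exp (4 * ∑ p ∈ Nat.primesBelow ((2 * k) ^ 4), (p : ℝ) ^ (σ - 1)) ≤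
      Real.exp (-M) / 2) :
    P.real {ω | ∑ n ∈ Finset.Icc 1 ⌊x⌋₊,
        completelyMultiplicativeExt (fun p => Y p ω) n / (n : ℝ) < 0} ≤
      2 * Real.exp 3 * (Real.exp (3 * M) / k) ^ (2 * k) := by
  have hmom := hY.integral_sum_nonsmooth_pow_le hsign hk hkx
  set w : ℕ := (2 * k) ^ 4 with hw
  -- Smoothness requires prime factors strictly below the bound, so the `+ 1` makes every positive
  -- `n ≤ x` an `N`-smooth number.
  set N : ℕ := ⌊x⌋₊ + 1 with hN
  set M' := ∑ p ∈ w.primesBelow, (1 : ℝ) / p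
  set h : Ω → ℕ →*₀ ℝ := fun ω => completelyMultiplicativeDiv (fun p => Y p ω) with hh
  set Z : Ω → ℝ := fun ω =>
    ∑ n ∈ Finset.range N, (N.smoothNumbers \ w.smoothNumbers).indicator (h ω) n with hZ
  have hbd : ∀ ω n, |h ω n| ≤ 1 / n := fun ω n =>
    abs_completelyMultiplicativeDiv_le (fun p => abs_le_one_of_sign (hsign p ω)) n
  set δ := Real.exp (-M) / 2 with hδ
  have hδ0 : 0 < δ := by positivity
  have hsub : {ω | ∑ n ∈ Finset.Icc 1 ⌊x⌋₊,
        completelyMultiplicativeExt (fun p => Y p ω) n / (n : ℝ) < 0} ⊆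
      {ω | δ ^ (2 * k) ≤ Z ω ^ (2 * k)} := by
    intro ω hω
    rw [Set.mem_ofPred_eq] at hω ⊢
    have hdecomp : ∑ n ∈ Finset.Icc 1 ⌊x⌋₊,
        completelyMultiplicativeExt (fun p => Y p ω) n / (n : ℝ) =
        ∑ n ∈ Finset.range N, w.smoothNumbers.indicator (h ω) n + Z ω := by
      rw [hZ, ← Finset.sum_add_distrib]
      have : Finset.range N = insert 0 (Finset.Icc 1 ⌊x⌋₊) := by
        ext n; simp only [Finset.mem_range, Finset.mem_insert, Finset.mem_Icc]; omega
      rw [this, Finset.sum_insert (by simp)]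
      have h0 : ∀ S : Set ℕ, S.indicator (h ω) 0 = 0 := fun S => by
        rw [Set.indicator_apply_eq_zero]; exact fun _ => map_zero _
      rw [h0, h0, add_zero, zero_add]
      refine Finset.sum_congr rfl fun n hn => ?_
      rw [Finset.mem_Icc] at hn
      have hnN : n ∈ N.smoothNumbers := Nat.mem_smoothNumbers_of_lt hn.1 (by omega)
      rw [← completelyMultiplicativeDiv_apply]
      by_cases hnw : n ∈ w.smoothNumbers
      · rw [Set.indicator_of_mem hnw, Set.indicator_of_notMem (fun h => h.2 hnw), add_zero]
      · rw [Set.indicator_of_notMem hnw, Set.indicator_of_mem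
          (show n ∈ N.smoothNumbers \ w.smoothNumbers from ⟨hnN, hnw⟩), zero_add]
    rw [hdecomp] at hω
    have h1 := (abs_le.1 (abs_sum_smoothNumbers_sub_eulerProduct_le (hbd ω) w hx hσ0 hσ)).1
    have h2 := exp_neg_le_eulerProduct (hbd ω) w
    have h3 : Real.exp (-M) ≤ Real.exp (-M') := Real.exp_le_exp.2 (by linarith)
    have hlow : δ ≤ |Z ω| := by
      refine le_trans ?_ (neg_le_abs _)
      linarith
    rw [← (even_two_mul k).pow_abs (Z ω)]
    exact pow_le_pow_left₀ hδ0.le hlow _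
  have hZm : Measurable Z := by
    refine Finset.measurable_fun_sum _ fun n _ => ?_
    by_cases hn : n ∈ N.smoothNumbers \ w.smoothNumbers
    · simp only [Set.indicator_of_mem hn]
      exact hY.measurable_completelyMultiplicativeDiv n
    · simp only [Set.indicator_of_notMem hn]
      exact measurable_const
  have hZint : Integrable (fun ω => Z ω ^ (2 * k)) P := by
    refine integrable_of_measurable_of_abs_le (hZm.pow_const _)
      (C := (∑ n ∈ Finset.range N, (1 : ℝ) / n) ^ (2 * k)) fun ω => ?_
    rw [abs_pow]
    refine pow_le_pow_left₀ (abs_nonneg _) ?_ _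
    refine (Finset.abs_sum_le_sum_abs _ _).trans (Finset.sum_le_sum fun n _ => ?_)
    refine le_trans ?_ (hbd ω n)
    simpa only [Real.norm_eq_abs] using norm_indicator_le_norm_self (h ω) n
  have hmarkov := mul_meas_ge_le_integral_of_nonneg
    (Filter.Eventually.of_forall fun ω => (even_two_mul k).pow_nonneg (Z ω)) hZint (δ ^ (2 * k))
  have hk0 : (0 : ℝ) < k := by exact_mod_cast hk
  refine (measureReal_mono hsub).trans ?_
  have hδk : 0 < δ ^ (2 * k) := by positivity
  rw [← le_div_iff₀' hδk] at hmarkov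
  refine hmarkov.trans ((div_le_div_of_nonneg_right hmom hδk.le).trans ?_)
  rw [div_le_iff₀ hδk]
  have hA : Real.exp (2 * M') ≤ Real.exp (2 * M) := Real.exp_le_exp.2 (by linarith)
  calc Real.exp (2 * M') ^ (2 * k) * (2 * Real.exp 3 / (2 * k) ^ (2 * k))
      ≤ Real.exp (2 * M) ^ (2 * k) * (2 * Real.exp 3 / (2 * k) ^ (2 * k)) := by gcongr
    _ = 2 * Real.exp 3 * (Real.exp (2 * M) / (2 * k)) ^ (2 * k) := by rw [div_pow]; ring
    -- The `2` in `2k` cancels the one in `δ = exp(-M)/2`, and dividing by `δ` turns `exp(2M)` into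
    -- `exp(3M)`.
    _ = 2 * Real.exp 3 * (Real.exp (3 * M) / k * δ) ^ (2 * k) := by
        congr 2
        rw [hδ, show 2 * M = 3 * M + -M by ring, Real.exp_add]
        field_simp
    _ = _ := by rw [mul_pow]; ring

theorem IsRademacherOnPrimes.prob_sum_neg_le {X : ℕ → Ω → ℝ}
    (hX : IsRademacherOnPrimes P X) {k : ℕ} (hk : 0 < k) {x σ M : ℝ} (hx : 0 < x)
    (hkx : (2 * k) ^ 4 ≤ ⌊x⌋₊ + 1) (hσ0 : 0 ≤ σ) (hσ : σ ≤ 1 / 2)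
    (hM : ∑ p ∈ Nat.primesBelow ((2 * k) ^ 4), (1 : ℝ) / p ≤ M)
    (htail : x ^ (-σ) * Real.exp (4 * ∑ p ∈ Nat.primesBelow ((2 * k) ^ 4), (p : ℝ) ^ (σ - 1)) ≤
      Real.exp (-M) / 2) :
    P.real {ω | ∑ n ∈ Finset.Icc 1 ⌊x⌋₊,
        completelyMultiplicativeExt (fun p => X p ω) n / (n : ℝ) < 0} ≤
      2 * Real.exp 3 * (Real.exp (3 * M) / k) ^ (2 * k) := by
  classical
  -- The values of `X p` are `±1` only almost surely, and those at non-primes are arbitrary.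
  -- Composing with `φ` makes them `±1` everywhere and changes the prime values only on a null set.
  let φ : ℝ → ℝ := fun t => if t = 1 then 1 else -1
  have hφ : Measurable φ :=
    Measurable.ite (measurableSet_singleton 1) measurable_const measurable_const
  let Y : ℕ → Ω → ℝ := fun n ω => φ (X n ω)
  have hsign : ∀ n ω, Y n ω = 1 ∨ Y n ω = -1 := fun n ω => by
    simp only [Y, φ]; split_ifs <;> simp
  have hae : ∀ p : ℕ, p.Prime → ∀ᵐ ω ∂P, X p ω = 1 ∨ X p ω = -1 := by
    intro p hp
    have h1 : MeasurableSet {ω | X p ω = 1} := hX.measurable p hp (measurableSet_singleton 1)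
    have h2 : MeasurableSet {ω | X p ω = -1} := hX.measurable p hp (measurableSet_singleton (-1))
    have hdisj : Disjoint {ω | X p ω = 1} {ω | X p ω = -1} := by
      rw [Set.disjoint_left]
      intro ω (h : X p ω = 1) (h' : X p ω = -1)
      norm_num [h] at h'
    have hunion : P.real ({ω | X p ω = 1} ∪ {ω | X p ω = -1}) = 1 := by
      rw [measureReal_union hdisj h2, hX.prob_one p hp, hX.prob_neg_one p hp]
      norm_num
    have hc := probReal_compl_eq_one_sub (μ := P) (h1.union h2)
    rw [hunion, sub_self, measureReal_eq_zero_iff] at hc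
    exact hc
  have hXY : ∀ p : ℕ, p.Prime → ∀ᵐ ω ∂P, Y p ω = X p ω := by
    intro p hp
    filter_upwards [hae p hp] with ω hω
    rcases hω with h | h <;> norm_num [Y, φ, h]
  have hYr : IsRademacherOnPrimes P Y := by
    refine ⟨fun p hp => hφ.comp (hX.measurable p hp), hX.indep.comp (fun _ => φ) fun _ => hφ,
      fun p hp => ?_, fun p hp => ?_⟩
    · rw [← hX.prob_one p hp]
      refine measureReal_congr ?_
      filter_upwards [hXY p hp] with ω hω
      exact propext (by change Y p ω = 1 ↔ X p ω = 1; rw [hω])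
    · rw [← hX.prob_neg_one p hp]
      refine measureReal_congr ?_
      filter_upwards [hXY p hp] with ω hω
      exact propext (by change Y p ω = -1 ↔ X p ω = -1; rw [hω])
  refine le_of_eq_of_le (measureReal_congr ?_)
    (hYr.prob_sum_neg_le_of_sign hsign hk hx hkx hσ0 hσ hM htail)
  have hall : ∀ᵐ ω ∂P, ∀ p : ℕ, p.Prime → Y p ω = X p ω :=
    ae_all_iff.2 fun p => by
      by_cases hp : p.Prime
      · simpa only [hp, forall_const] using hXY p hp
      · simp [hp]
  filter_upwards [hall] with ω hω
  have : ∀ n : ℕ, completelyMultiplicativeExt (fun p => X p ω) n =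
      completelyMultiplicativeExt (fun p => Y p ω) n := fun n => by
    simp only [completelyMultiplicativeExt, Finsupp.prod]
    refine Finset.prod_congr rfl fun p hp => ?_
    rw [Nat.support_factorization] at hp
    simp only [hω p (Nat.prime_of_mem_primeFactors hp)]
  refine propext ?_
  change (∑ n ∈ _, _ < (0 : ℝ)) ↔ (∑ n ∈ _, _ < (0 : ℝ))
  simp only [this]

end

/-! ### Choice of parameters -/

theorem eventually_mul_log_add_le (c d : ℝ) :
    ∀ᶠ a : ℝ in Filter.atTop, c * Real.log (8 * a) + d ≤ a := by
  have h1 : Filter.Tendsto (fun a : ℝ => 8 * a) Filter.atTop Filter.atTop :=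
    Filter.tendsto_id.const_mul_atTop (by norm_num)
  have hc : (0 : ℝ) < 1 / (16 * (|c| + 1)) := by positivity
  filter_upwards [h1.eventually (Real.isLittleO_log_id_atTop.def hc),
    Filter.eventually_ge_atTop (2 * |d|), Filter.eventually_ge_atTop 0] with a h2 h3 h4
  rw [id, Real.norm_eq_abs, Real.norm_of_nonneg (by positivity), div_mul_eq_mul_div,
    le_div_iff₀ (by positivity)] at h2
  have h5 : c * Real.log (8 * a) ≤ (|c| + 1) * |Real.log (8 * a)| := by
    rw [add_mul, ← abs_mul]
    linarith [le_abs_self (c * Real.log (8 * a)), abs_nonneg (Real.log (8 * a))]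
  linarith [le_abs_self d]

theorem eventually_loglog_bounds (c : ℝ) :
    ∀ᶠ x : ℝ in Filter.atTop, 1 ≤ Real.log (Real.log x) ∧
      1 ≤ Real.log (Real.log (Real.log x)) ∧ c * Real.log (Real.log x) ≤ Real.log x := by
  have hl := Real.tendsto_log_atTop
  have hll := hl.comp hl
  have hc : (0 : ℝ) < 1 / (|c| + 1) := by positivity
  filter_upwards [hll.eventually_ge_atTop 1, (hl.comp hll).eventually_ge_atTop 1,
    hl.eventually (Real.isLittleO_log_id_atTop.def hc), hl.eventually_ge_atTop 0] with x h1 h2 h3 h4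
  refine ⟨h1, h2, ?_⟩
  simp only [Function.comp_apply] at h1
  rw [id, Real.norm_of_nonneg (by linarith), Real.norm_of_nonneg h4, div_mul_eq_mul_div,
    le_div_iff₀ (by positivity), one_mul] at h3
  nlinarith [le_abs_self c]

theorem theorem1p2 :
    ∃ C : ℝ, 0 < C ∧ ∃ K : ℝ, 0 < K ∧ ∃ x₀ : ℝ,
      ∀ (Ω : Type*) [MeasurableSpace Ω] (P : Measure Ω) [IsProbabilityMeasure P]
        (X : ℕ → Ω → ℝ), IsRademacherOnPrimes P X →
        ∀ x : ℝ, x₀ ≤ x →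
          P.real {ω | ∑ n ∈ Finset.Icc 1 ⌊x⌋₊,
              completelyMultiplicativeExt (fun p => X p ω) n / (n : ℝ) < 0} ≤
            K * Real.exp (-Real.exp
              (Real.log x * Real.log (Real.log (Real.log x)) / (C * Real.log (Real.log x)))) := by
  -- Below, `3M + 1 = 18 log(log w) + 22` with `log w ≤ 8a`, and this must not exceed `a`.
  obtain ⟨a₀, ha₀⟩ := Filter.eventually_atTop.1 (eventually_mul_log_add_le 18 22)
  obtain ⟨x₀, hx₀⟩ := Filter.eventually_atTop.1
    ((eventually_loglog_bounds (1248 * (|a₀| + 4))).and (Filter.eventually_gt_atTop 1))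
  refine ⟨1248, by norm_num, 2 * Real.exp 3, by positivity, x₀, ?_⟩
  intro Ω _ P _ X hX x hx
  obtain ⟨⟨h2, h3, hL⟩, hx1⟩ := hx₀ x hx
  set L := Real.log x with hLdef
  set L2 := Real.log L with hL2def
  set L3 := Real.log L2 with hL3def
  set a := L * L3 / (1248 * L2) with ha
  have hx0 : 0 < x := by linarith
  have hL0 : 0 < L := Real.log_pos hx1
  have hL3le : L3 ≤ L2 := Real.log_le_self (by linarith)
  have haL3 : (|a₀| + 4) * L3 ≤ a := by
    rw [ha, le_div_iff₀ (by positivity)]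
    nlinarith
  have haa : |a₀| + 4 ≤ a := by nlinarith [abs_nonneg a₀]
  have ha4 : 4 ≤ a := by linarith [abs_nonneg a₀]
  have haL : 8 * a ≤ L := by
    rw [ha, mul_div_assoc', div_le_iff₀ (by positivity)]
    nlinarith
  -- The final bound is of order `exp(-2k)`, so `k ≥ exp a` is what the target asks for.
  set k := ⌈Real.exp a⌉₊ with hk
  have hEk : Real.exp a ≤ k := Nat.le_ceil _
  have hE1 : 1 ≤ Real.exp a := Real.one_le_exp (by linarith)
  have hkE : (k : ℝ) ≤ 2 * Real.exp a := by
    linarith [Nat.ceil_lt_add_one (Real.exp_pos a).le]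
  have hk0r : (0 : ℝ) < k := (Real.exp_pos a).trans_le hEk
  have hk0 : 0 < k := by exact_mod_cast hk0r
  set w := (2 * k) ^ 4 with hw
  have hw2 : 2 ≤ w := by
    calc 2 ≤ 2 * k := by omega
      _ = (2 * k) ^ 1 := (pow_one _).symm
      _ ≤ (2 * k) ^ 4 := Nat.pow_le_pow_right (by omega) (by norm_num)
  have hw0 : (0 : ℝ) < w := by positivity
  have hlogw : Real.log w = 4 * Real.log (2 * k) := by
    rw [hw]; push_cast; rw [Real.log_pow]; norm_num
  have hlogk : a ≤ Real.log k := (Real.le_log_iff_exp_le hk0r).2 hEk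
  have hlogw_ge : 4 * a ≤ Real.log w := by
    rw [hlogw]
    have : Real.log k ≤ Real.log (2 * k) := Real.log_le_log hk0r (by linarith)
    linarith
  have hlogw_le : Real.log w ≤ 8 * a := by
    rw [hlogw]
    have h1 : Real.log (2 * k) ≤ Real.log (4 * Real.exp a) :=
      Real.log_le_log (by positivity) (by linarith)
    rw [Real.log_mul (by norm_num) (Real.exp_pos a).ne', Real.log_exp] at h1
    linarith [Real.log_le_self (x := 4) (by norm_num)]
  have hlogw0 : 0 < Real.log w := by linarith
  have hwx : w ≤ ⌊x⌋₊ := Nat.le_floor <|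
    (Real.log_le_log_iff hw0 hx0).1 (hlogw_le.trans haL)
  set M := 6 * Real.log (Real.log w) + 7 with hMdef
  have hM : ∑ p ∈ w.primesBelow, (1 : ℝ) / p ≤ M := sum_inv_primesBelow_le hw2
  have hML2 : M ≤ 6 * L2 + 7 := by
    have : Real.log (Real.log w) ≤ L2 := Real.log_le_log hlogw0 (hlogw_le.trans haL)
    linarith
  have hMa : 3 * M + 1 ≤ a := by
    have h1 : Real.log (Real.log w) ≤ Real.log (8 * a) := Real.log_le_log hlogw0 hlogw_le
    linarith [ha₀ a (by linarith [le_abs_self a₀])]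
  -- Makes `w^σ = exp(L3/2) ≤ L2`, so the Rankin Euler product costs only a power of `log x`.
  set σ := L3 / (2 * Real.log w) with hσ
  have hσ0 : 0 ≤ σ := by positivity
  have hσ2 : σ ≤ 1 / 2 := by
    rw [hσ, div_le_iff₀ (by positivity)]
    nlinarith [abs_nonneg a₀]
  have hwσ : (w : ℝ) ^ σ ≤ L2 := by
    rw [Real.rpow_def_of_pos hw0, ← Real.le_log_iff_exp_le (by linarith), hσ, ← hL3def]
    have : Real.log w * (L3 / (2 * Real.log w)) = L3 / 2 := by field_simp
    linarith
  -- The tail needs `σL ≥ 5M + 12 L2 + 1`, and the right side is at most `42 L2 + 36 ≤ 78 L2`. Since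
  -- `log w ≤ 8a`, `σL ≥ L L3 / (16a)`, which dictates `C = 16 · 78 = 1248`.
  have hσL : 78 * L2 ≤ σ * L := by
    rw [hσ, div_mul_eq_mul_div, le_div_iff₀ (by positivity)]
    have : 8 * a * (156 * L2) = L3 * L := by rw [ha]; field_simp; ring
    nlinarith
  have htail : x ^ (-σ) * Real.exp (4 * ∑ p ∈ w.primesBelow, (p : ℝ) ^ (σ - 1)) ≤
      Real.exp (-M) / 2 := by
    have h1 := sum_rpow_sub_one_primesBelow_le hw2 σ
    rw [le_div_iff₀ two_pos, Real.rpow_def_of_pos hx0, ← Real.exp_add]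
    calc _ ≤ Real.exp (-M - 1) * 2 := by
          gcongr
          rw [← hLdef]
          linarith
      _ ≤ Real.exp (-M - 1) * Real.exp 1 := by
          gcongr
          linarith [Real.add_one_le_exp (1 : ℝ)]
      _ = Real.exp (-M) := by rw [← Real.exp_add, sub_add_cancel]
  refine (hX.prob_sum_neg_le hk0 hx0 (hwx.trans (Nat.le_succ _)) hσ0 hσ2 hM htail).trans ?_
  gcongr
  have h1 : Real.exp (3 * M) / k ≤ Real.exp (-1) := by
    rw [div_le_iff₀ hk0r]
    calc Real.exp (3 * M) ≤ Real.exp (-1) * Real.exp a := by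
          rw [← Real.exp_add]; exact Real.exp_le_exp.2 (by linarith)
      _ ≤ _ := by gcongr
  calc _ ≤ Real.exp (-1) ^ (2 * k) := by gcongr
    _ = Real.exp (-(2 * k)) := by rw [← Real.exp_nat_mul]; push_cast; ring_nf
    _ ≤ _ := Real.exp_le_exp.2 (by linarith)
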